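/- Let $a<b$ be real numbers, let $L=L(x,u,v)\in C([a,b]\times\mathbb R\times\mathbb R)$, let $K\subset[a,b]\times\mathbb R$ be compact, and let $\omega:[0,\infty[\times[0,\infty[\to[0,\infty[$ be nondecreasing in both arguments with $\omega(k,0)=0$ for all $k\ge 0$. Write $W^{1,1}([a,b])$ for the class of absolutely continuous $u:[a,b]\to\mathbb R$, and $J_L(u;[a,b])=\int_a^bL(x,u(x),u'(x))\,dx$. For $s<t$ in $[a,b]$ let $k_u(s,t)=\frac{u(s)-u(t)}{s-t}$, and let $u_{s,t}$ be the function equal to $u(s)+k_u(s,t)(x-s)$ on $]s,t[$ and to $u$ on $[a,b]\setminus\,]s,t[$. For $c>0$ and $\delta_0>0$, let $\mathcal L_\omega(L,K,c,\delta_0)$ be the class of $u\in W^{1,1}([a,b])$ such that (A$_1$) $(x,u(x))\in K$ for all $x\in[a,b]$; (A$_2$) $L(\cdot,u,u')$ is integrable and $J_L(u;[a,b])\le c$; (A$_3$) for all $s<t$ in $[a,b]$ with $|s-t|\le\delta_0$: $\;J_L(u;[a,b])\le J_L(u_{s,t};[a,b])+\omega(|k_u(s,t)|,|s-t|)\,|s-t|$.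 Assume: (H$_1$) for each compact $G\subset[a,b]\times\mathbb R\times\mathbb R$ there are $C,\alpha>0$ such that $|L(x_1,u_1,v_1)-L(x_2,u_2,v_2)|\le C(|x_1-x_2|+|u_1-u_2|+|v_1-v_2|)^{\alpha}$ for all $(x_1,u_1,v_1),(x_2,u_2,v_2)\in G$; (H$_2$) $L_{vv}$ exists and is continuous on $[a,b]\times\mathbb R\times\mathbb R$, and $L_{vv}\ge\mu$ everywhere for a constant $\mu>0$. Let $c>0$, and let $N>0$ be such that $\|u'\|_{L^2([a,b])}\le N$ for every $u\in W^{1,1}([a,b])$ satisfying (A$_1$) and (A$_2$). Let $\delta_0\in\Delta_c:=\{\delta>0:\delta+N\sqrt{\delta}\le1\}$. Put $$K_0=\Big\{(t,w)\in[a,b]\times\mathbb R:\ \inf_{(x,y)\in K}\big(|x-t|+|y-w|\big)\le\delta_0+N\sqrt{\delta_0}\Big\}$$ and, for $k\ge0$, $c(k)=\max\big\{\sup_{K_0\times[-k,k]}|L|,\ \sup_{K_0\times[-k,k]}|L_v|\big\}$. For each $k\ge0$ let $M(k)>0$ be such that $$|\zeta|\ge M(k)\ \Longrightarrow\ \tfrac{\mu}{4}\zeta^2-2c(k)(|\zeta|+1)\ge\omega\big(k,\delta_0+N\sqrt{\delta_0}\big),$$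 and let $\alpha(k)>0$ be a Hölder exponent of $L$, in the sense of (H$_1$), on $G=K_0\times[-(k+M(k)),k+M(k)]$. Put $\widehat\omega(k,\varepsilon)=\sqrt{\omega(k,\varepsilon+N\sqrt{\varepsilon})}$ and $\overline\omega(k,\varepsilon)=\big[\sqrt{\widehat\omega(k,\varepsilon)}\big]^{\alpha(k)}+\sqrt{\widehat\omega(k,\varepsilon)}+\widehat\omega(k,\varepsilon)$. Assume moreover (H$^{K,\delta_0}_\omega$) $\displaystyle\lim_{\varepsilon\to0^+}\int_0^{\mathrm e\varepsilon}\overline\omega(k,\xi)\frac{d\xi}{\xi}=0$ for all $k\ge0$. Then every $u\in\mathcal L_\omega(L,K,c,\delta_0)$ has Tonelli's partial regularity, that is, writing $\Omega_u$ for the set of $x\in[a,b]$ at which $u$ is differentiable (one-sidedly at $a$ and $b$): (i) $\Omega_u$ is open in $[a,b]$; (ii) $[a,b]\setminus\Omega_u=\{x\in[a,b]:u'(x)=-\infty\text{ or }u'(x)=\infty\}$, where $u'(x)=\pm\infty$ means that the difference quotients of $u$ at $x$ tend to $\pm\infty$; (iii) the function $u':[a,b]\to[-\infty,\infty]$, which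 by (ii) is defined everywhere, is continuous. -/

import Mathlib

open Set Filter Topology MeasureTheory

noncomputable section

namespace Tonelli

/-- The domain `[a,b] × ℝ × ℝ` of a Lagrangian `L(x,u,v)`. -/
def lagDomain (a b : ℝ) : Set (ℝ × ℝ × ℝ) := Icc a b ×ˢ (univ : Set (ℝ × ℝ))

/-- The partial derivative `L_v`. -/
def Lv (L : ℝ × ℝ × ℝ → ℝ) (p : ℝ × ℝ × ℝ) : ℝ :=
  deriv (fun v : ℝ => L (p.1, p.2.1, v)) p.2.2

/-- The second partial derivative `L_vv`. -/
def Lvv (L : ℝ × ℝ × ℝ → ℝ) (p : ℝ × ℝ × ℝ) : ℝ :=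
  deriv (fun v : ℝ => Lv L (p.1, p.2.1, v)) p.2.2

/-- `L` is Hölder continuous on `G` with constant `C` and exponent `α`. -/
def HolderOn (L : ℝ × ℝ × ℝ → ℝ) (G : Set (ℝ × ℝ × ℝ)) (C α : ℝ) : Prop :=
  ∀ p ∈ G, ∀ q ∈ G,
    |L p - L q| ≤ C * (|p.1 - q.1| + |p.2.1 - q.2.1| + |p.2.2 - q.2.2|) ^ α

/-- `L` is locally Hölder continuous: Hölder continuous on each compact subset of its domain,
with constant and exponent depending on that compact set. -/
def LocallyHolder (a b : ℝ) (L : ℝ × ℝ × ℝ → ℝ) : Prop :=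
  ∀ G : Set (ℝ × ℝ × ℝ), IsCompact G → G ⊆ lagDomain a b →
    ∃ C > 0, ∃ α > 0, HolderOn L G C α

/-- Global ellipticity: `L_vv` exists and is continuous on `[a,b] × ℝ × ℝ`, and `L_vv ≥ μ`. -/
structure GloballyElliptic (a b : ℝ) (L : ℝ × ℝ × ℝ → ℝ) (μ : ℝ) : Prop where
  differentiable_L : ∀ x ∈ Icc a b, ∀ u : ℝ, Differentiable ℝ (fun v : ℝ => L (x, u, v))
  differentiable_Lv : ∀ x ∈ Icc a b, ∀ u : ℝ, Differentiable ℝ (fun v : ℝ => Lv L (x, u, v))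
  continuousOn_Lvv : ContinuousOn (Lvv L) (lagDomain a b)
  le_Lvv : ∀ p ∈ lagDomain a b, μ ≤ Lvv L p

/-- The function under the integral sign in the energy `J_L(u;[a,b])`. -/
def energyDensity (L : ℝ × ℝ × ℝ → ℝ) (u : ℝ → ℝ) (x : ℝ) : ℝ := L (x, u x, deriv u x)

/-- The energy `J_L(u;[a,b]) = ∫_a^b L(x,u(x),u'(x)) dx`. -/
def energy (a b : ℝ) (L : ℝ × ℝ × ℝ → ℝ) (u : ℝ → ℝ) : ℝ :=
  ∫ x in a..b, energyDensity L u x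

/-- The slope `k_u(s,t)` of the chord of `u` between `s` and `t`. -/
def chordSlope (u : ℝ → ℝ) (s t : ℝ) : ℝ := (u s - u t) / (s - t)

open Classical in
/-- The function `u_{s,t}`: on `]s,t[` the function `u` is replaced by its chord. -/
def chordReplace (u : ℝ → ℝ) (s t : ℝ) (x : ℝ) : ℝ :=
  if x ∈ Ioo s t then u s + chordSlope u s t * (x - s) else u x

/-- `u ∈ W^{1,1}([a,b])` (that is, `u` is absolutely continuous on `[a,b]`), the graph of `u` over
`[a,b]` lies in `K`, and the energy of `u` is finite and at most `c`. -/
structure Admissible (a b : ℝ) (L : ℝ × ℝ × ℝ → ℝ) (K : Set (ℝ × ℝ)) (c : ℝ) (u : ℝ → ℝ) :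
    Prop where
  absolutelyContinuous : AbsolutelyContinuousOnInterval u a b
  graph_subset : ∀ x ∈ Icc a b, (x, u x) ∈ K
  integrable : IntervalIntegrable (energyDensity L u) volume a b
  energy_le : energy a b L u ≤ c

/-- `ω : [0,∞[ × [0,∞[ → [0,∞[` is nondecreasing in both arguments and `ω(k,0) = 0`. -/
structure IsModulus (ω : ℝ → ℝ → ℝ) : Prop where
  nonneg : ∀ k, 0 ≤ k → ∀ ε, 0 ≤ ε → 0 ≤ ω k ε
  mono_left : ∀ ε, 0 ≤ ε → MonotoneOn (fun k => ω k ε) (Ici 0)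
  mono_right : ∀ k, 0 ≤ k → MonotoneOn (fun ε => ω k ε) (Ici 0)
  apply_zero : ∀ k, 0 ≤ k → ω k 0 = 0

/-- The class `𝓛_ω(L,K,c,δ₀)`. -/
structure InClass (a b : ℝ) (L : ℝ × ℝ × ℝ → ℝ) (ω : ℝ → ℝ → ℝ) (K : Set (ℝ × ℝ)) (c δ₀ : ℝ)
    (u : ℝ → ℝ) : Prop extends Admissible a b L K c u where
  almost_min : ∀ s ∈ Icc a b, ∀ t ∈ Icc a b, s < t → |s - t| ≤ δ₀ →
    energy a b L u ≤
      energy a b L (chordReplace u s t) + ω |chordSlope u s t| |s - t| * |s - t|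

/-- `N > 0` bounds `‖u'‖_{L²([a,b])}` for every `u ∈ W^{1,1}([a,b])` with graph in `K` and energy
at most `c`. -/
def IsSlopeBound (a b : ℝ) (L : ℝ × ℝ × ℝ → ℝ) (K : Set (ℝ × ℝ)) (c N : ℝ) : Prop :=
  0 < N ∧ ∀ u : ℝ → ℝ, Admissible a b L K c u →
    eLpNorm (deriv u) 2 (volume.restrict (Icc a b)) ≤ ENNReal.ofReal N

/-- The set `Δ_c` of admissible `δ₀`; it depends on `c` through `N`. -/
def DeltaSet (N : ℝ) : Set ℝ := {δ | 0 < δ ∧ δ + N * √δ ≤ 1}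

/-- The `ℓ¹` distance from `(t,w)` to `K`. -/
def distTo (K : Set (ℝ × ℝ)) (q : ℝ × ℝ) : ℝ :=
  sInf ((fun p : ℝ × ℝ => |p.1 - q.1| + |p.2 - q.2|) '' K)

/-- The set `K₀` of points of `[a,b] × ℝ` at distance at most `δ₀ + N √δ₀` from `K`. -/
def K0 (a b : ℝ) (K : Set (ℝ × ℝ)) (N δ₀ : ℝ) : Set (ℝ × ℝ) :=
  {q | q.1 ∈ Icc a b ∧ distTo K q ≤ δ₀ + N * √δ₀}

/-- The set `K₀ × [-r,r]`. -/
def slab (a b : ℝ) (K : Set (ℝ × ℝ)) (N δ₀ r : ℝ) : Set (ℝ × ℝ × ℝ) :=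
  {p | (p.1, p.2.1) ∈ K0 a b K N δ₀ ∧ p.2.2 ∈ Icc (-r) r}

/-- `c(k)`: the larger of the suprema of `|L|` and `|L_v|` over `K₀ × [-k,k]`. -/
def cConst (a b : ℝ) (L : ℝ × ℝ × ℝ → ℝ) (K : Set (ℝ × ℝ)) (N δ₀ k : ℝ) : ℝ :=
  max (sSup ((fun p => |L p|) '' slab a b K N δ₀ k))
    (sSup ((fun p => |Lv L p|) '' slab a b K N δ₀ k))

/-- The defining property of `M(k) > 0`. -/
def IsMConst (a b : ℝ) (L : ℝ × ℝ × ℝ → ℝ) (μ : ℝ) (ω : ℝ → ℝ → ℝ) (K : Set (ℝ × ℝ))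
    (N δ₀ k M : ℝ) : Prop :=
  0 < M ∧ ∀ ζ : ℝ, M ≤ |ζ| →
    ω k (δ₀ + N * √δ₀) ≤ μ / 4 * ζ ^ 2 - 2 * cConst a b L K N δ₀ k * (|ζ| + 1)

/-- `α > 0` is a Hölder exponent of `L` on `K₀ × [-(k+M),k+M]`. -/
def IsHolderExponent (a b : ℝ) (L : ℝ × ℝ × ℝ → ℝ) (K : Set (ℝ × ℝ)) (N δ₀ k M α : ℝ) : Prop :=
  0 < α ∧ ∃ C > 0, HolderOn L (slab a b K N δ₀ (k + M)) C α

/-- `ω̂(k,ε) = √(ω(k, ε + N √ε))`. -/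
def omegaHat (ω : ℝ → ℝ → ℝ) (N k ε : ℝ) : ℝ := √(ω k (ε + N * √ε))

/-- `ω̄(k,ε) = (√ω̂)^α + √ω̂ + ω̂`, with `ω̂` taken at `(k,ε)` and `α = α(k)`. -/
def omegaBar (ω : ℝ → ℝ → ℝ) (N : ℝ) (α : ℝ → ℝ) (k ε : ℝ) : ℝ :=
  √(omegaHat ω N k ε) ^ α k + √(omegaHat ω N k ε) + omegaHat ω N k ε

/-- The Dini-type condition: for all `k ≥ 0`, `∫_0^{eε} ω̄(k,ξ) dξ/ξ → 0` as `ε → 0⁺`. The integral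
is that of a nonnegative function, with values in `[0,∞]`. -/
def DiniCondition (ω : ℝ → ℝ → ℝ) (N : ℝ) (α : ℝ → ℝ) : Prop :=
  ∀ k, 0 ≤ k →
    Tendsto (fun ε : ℝ =>
        ∫⁻ ξ in Ioo 0 (Real.exp 1 * ε), ENNReal.ofReal (omegaBar ω N α k ξ / ξ))
      (𝓝[>] 0) (𝓝 0)

/-- The set `Ω_u` of points of `[a,b]` at which `u : [a,b] → ℝ` is differentiable (one-sidedly
at the end points). -/
def diffSet (a b : ℝ) (u : ℝ → ℝ) : Set ℝ :=
  {x | x ∈ Icc a b ∧ DifferentiableWithinAt ℝ u (Icc a b) x}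

/-- `u'(x) = d` in `[-∞,∞]`: the difference quotients of `u : [a,b] → ℝ` at `x` tend to `d`. -/
def HasExtDeriv (a b : ℝ) (u : ℝ → ℝ) (x : ℝ) (d : EReal) : Prop :=
  Tendsto (fun y : ℝ => ((chordSlope u x y : ℝ) : EReal)) (𝓝[Icc a b \ {x}] x) (𝓝 d)

/-- Tonelli's partial regularity on `[a,b]`. -/
structure PartialRegularity (a b : ℝ) (u : ℝ → ℝ) : Prop where
  isOpen_diffSet : ∃ U : Set ℝ, IsOpen U ∧ diffSet a b u = U ∩ Icc a b
  compl_diffSet : Icc a b \ diffSet a b u =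
    {x | x ∈ Icc a b ∧ (HasExtDeriv a b u x ⊥ ∨ HasExtDeriv a b u x ⊤)}
  continuous_deriv : ∃ D : ℝ → EReal, (∀ x ∈ Icc a b, HasExtDeriv a b u x (D x)) ∧
    ContinuousOn D (Icc a b)

end Tonelli

end

/-!
Write `k(I)` for the slope of the chord of `u` over an interval `I ⊆ [a,b]`. Partial regularity is
a statement about these slopes only: it holds as soon as, on short intervals `I` with `|k(I)|`
bounded, all subintervals `J ⊆ I` have `k(J)` close to `k(I)` (`SmallOscillation`). Indeed a
continuity argument then shows that subchords of steep short chords are steep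
(`SmallOscillation.le_of_steep`), so that `arctan k(J)` is uniformly close to `arctan k(I)` for all
short `I` (`SmallOscillation.arctan_sub_le`). Hence the slopes of chords at `x` converge in
`[-∞,∞]`, uniformly in `x`, which gives a continuous extended derivative
(`SmallOscillation.partialRegularity`).

The oscillation of slopes is controlled by comparing `u` with its chord. On a compact set of
arguments, `L_v` inherits Hölder continuity in `(x,u)` from `L` and the bound on `L_vv`
(`exists_holder_bounds`). With ellipticity, and since `u' - k(I)` has mean zero on `I`, almost
minimality shows that the mean of `(u' - k(I))²` over `I` is at most a constant times
`|I|^β + ω(k,|I|)` if `|k(I)| ≤ k` (`exists_integral_sq_deriv_sub_le`). By the Cauchy–Schwarz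
inequality, `|k(J) - k(I)|` is bounded by the root of this quantity if `J ⊆ I` has at least half
the length. For general `J` the estimate is iterated along halved intervals, as in Campanato's
method (`smallOscillation_of_step`); the resulting sums over dyadic scales are small by the Dini
condition, of which only the term `ω̂ ≥ √ω` is used (`smallDyadicSums_sqrt_of_dini`).
-/

namespace Tonelli

/-! ### Chord slopes and extended derivatives -/

lemma chordSlope_comm (u : ℝ → ℝ) (s t : ℝ) : chordSlope u s t = chordSlope u t s := by
  unfold chordSlope
  rw [← neg_sub (u t), ← neg_sub t, neg_div_neg_eq]

lemma chordSlope_neg (u : ℝ → ℝ) (s t : ℝ) :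
    chordSlope (fun x => -u x) s t = -chordSlope u s t := by
  unfold chordSlope
  ring

/-- On short intervals with slope at most `k` in absolute value, the slopes of all subchords are
close to the slope of the chord, uniformly in the interval. -/
def SmallOscillation (a b : ℝ) (u : ℝ → ℝ) : Prop :=
  ∀ k : ℝ, 0 ≤ k → ∀ ε : ℝ, 0 < ε → ∃ h : ℝ, 0 < h ∧ ∀ s t p q : ℝ, a ≤ s → s ≤ p → p < q →
    q ≤ t → t ≤ b → t - s ≤ h → |chordSlope u s t| ≤ k →
      |chordSlope u p q - chordSlope u s t| ≤ ε

lemma SmallOscillation.neg {a b : ℝ} {u : ℝ → ℝ} (H : SmallOscillation a b u) :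
    SmallOscillation a b (fun x => -u x) := by
  intro k hk ε hε
  obtain ⟨h, hh, H⟩ := H k hk ε hε
  refine ⟨h, hh, fun s t p q h1 h2 h3 h4 h5 h6 h7 => ?_⟩
  rw [chordSlope_neg, abs_neg] at h7
  have := H s t p q h1 h2 h3 h4 h5 h6 h7
  rw [chordSlope_neg, chordSlope_neg, neg_sub_neg, abs_sub_comm]
  exact this

/-- If a short chord is steep, then so are all its subchords: otherwise an intermediate interval
would have a slope of moderate size, which all its subchords nearly share. -/
lemma SmallOscillation.le_of_steep {a b : ℝ} {u : ℝ → ℝ} (H : SmallOscillation a b u)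
    (hu : ContinuousOn u (Icc a b)) (k : ℝ) (hk : 0 ≤ k) :
    ∃ h : ℝ, 0 < h ∧ ∀ s t p q : ℝ, a ≤ s → s ≤ p → p < q → q ≤ t → t ≤ b → t - s ≤ h →
      k + 1 ≤ chordSlope u s t → k ≤ chordSlope u p q := by
  obtain ⟨h, hh, H⟩ := H (k + 1) (by linarith) 1 one_pos
  refine ⟨h, hh, fun s t p q h1 h2 h3 h4 h5 h6 h7 => ?_⟩
  by_contra hlt
  push Not at hlt
  -- The intervals `[s', t']` shrink linearly from `[s, t]` to `[p, q]`.
  have key : ∀ τ ∈ Icc (0 : ℝ) 1, s ≤ s + τ * (p - s) ∧ s + τ * (p - s) ≤ p ∧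
      q ≤ t + τ * (q - t) ∧ t + τ * (q - t) ≤ t := by
    rintro τ ⟨h0, h1'⟩
    refine ⟨?_, ?_, ?_, ?_⟩ <;> nlinarith
  have hc : ContinuousOn
      (fun τ : ℝ => chordSlope u (s + τ * (p - s)) (t + τ * (q - t))) (Icc 0 1) := by
    unfold chordSlope
    refine ContinuousOn.div (ContinuousOn.sub ?_ ?_) (by fun_prop) ?_
    · refine hu.comp (by fun_prop) fun τ hτ => ?_
      obtain ⟨k1, k2, k3, k4⟩ := key τ hτ
      constructor <;> linarith
    · refine hu.comp (by fun_prop) fun τ hτ => ?_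
      obtain ⟨k1, k2, k3, k4⟩ := key τ hτ
      constructor <;> linarith
    · intro τ hτ
      obtain ⟨k1, k2, k3, k4⟩ := key τ hτ
      exact (by linarith : s + τ * (p - s) - (t + τ * (q - t)) < 0).ne
  have hivt := intermediate_value_Icc' (zero_le_one' ℝ) hc
  have hmem : k + 1 ∈ Icc (chordSlope u (s + 1 * (p - s)) (t + 1 * (q - t)))
      (chordSlope u (s + 0 * (p - s)) (t + 0 * (q - t))) := by
    constructor
    · rw [one_mul, one_mul, add_sub_cancel, add_sub_cancel]; linarith
    · simpa using h7
  obtain ⟨τ, hτ, hτe⟩ := hivt hmem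
  obtain ⟨k1, k2, k3, k4⟩ := key τ hτ
  simp only at hτe
  have := H _ _ p q (by linarith : a ≤ s + τ * (p - s)) k2 h3 k3 (by linarith) (by linarith)
    (by rw [hτe, abs_of_nonneg (by linarith)])
  rw [hτe, abs_le] at this
  linarith [this.1]

lemma abs_arctan_sub_arctan_le (x y : ℝ) : |Real.arctan x - Real.arctan y| ≤ |x - y| := by
  have := Convex.norm_image_sub_le_of_norm_deriv_le (f := Real.arctan) (C := 1) (s := univ)
    (x := y) (y := x) (fun z _ => Real.differentiableAt_arctan z) (fun z _ => by
      rw [Real.deriv_arctan, Real.norm_of_nonneg (by positivity)]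
      exact (div_le_one (by positivity)).2 (by nlinarith [sq_nonneg z])) convex_univ
      (mem_univ _) (mem_univ _)
  simpa using this

/-- After the compactification `arctan`, slopes of subchords of short chords are uniformly close
to the slope of the chord, whatever its size. -/
lemma SmallOscillation.arctan_sub_le {a b : ℝ} {u : ℝ → ℝ} (H : SmallOscillation a b u)
    (hu : ContinuousOn u (Icc a b)) (ε : ℝ) (hε : 0 < ε) :
    ∃ h : ℝ, 0 < h ∧ ∀ s t p q : ℝ, a ≤ s → s ≤ p → p < q → q ≤ t → t ≤ b → t - s ≤ h →
      |Real.arctan (chordSlope u p q) - Real.arctan (chordSlope u s t)| ≤ ε := by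
  have hev : ∀ᶠ k : ℝ in atTop, Real.pi / 2 - ε < Real.arctan k :=
    (Real.tendsto_arctan_atTop.mono_right nhdsWithin_le_nhds).eventually
      (lt_mem_nhds (by linarith))
  obtain ⟨k, hkε, hk⟩ := (hev.and (eventually_ge_atTop 0)).exists
  obtain ⟨h₁, hh₁, H₁⟩ := H (k + 1) (by linarith) ε hε
  obtain ⟨h₂, hh₂, H₂⟩ := H.le_of_steep hu k hk
  obtain ⟨h₃, hh₃, H₃⟩ := H.neg.le_of_steep hu.neg k hk
  refine ⟨min h₁ (min h₂ h₃), by positivity, fun s t p q i1 i2 i3 i4 i5 i6 => ?_⟩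
  have j1 := i6.trans (min_le_left _ _)
  have j2 := i6.trans ((min_le_right _ _).trans (min_le_left _ _))
  have j3 := i6.trans ((min_le_right _ _).trans (min_le_right _ _))
  have near : ∀ x y : ℝ, k ≤ x → k ≤ y → |Real.arctan x - Real.arctan y| ≤ ε := by
    intro x y hx hy
    have a1 := Real.arctan_strictMono.monotone hx
    have a2 := Real.arctan_strictMono.monotone hy
    have a3 := Real.arctan_lt_pi_div_two x
    have a4 := Real.arctan_lt_pi_div_two y
    rw [abs_le]
    constructor <;> linarith
  rcases le_or_gt |chordSlope u s t| (k + 1) with hle | hgt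
  · exact (abs_arctan_sub_arctan_le _ _).trans (H₁ s t p q i1 i2 i3 i4 i5 j1 hle)
  · rcases lt_abs.1 hgt with hp | hn
    · exact near _ _ (H₂ s t p q i1 i2 i3 i4 i5 j2 hp.le) (by linarith)
    · have := H₃ s t p q i1 i2 i3 i4 i5 j3 (by rw [chordSlope_neg]; exact hn.le)
      rw [chordSlope_neg] at this
      have := near _ _ this (by linarith : k ≤ -chordSlope u s t)
      rwa [Real.arctan_neg, Real.arctan_neg, neg_sub_neg, abs_sub_comm] at this

lemma SmallOscillation.arctan_sub_le_of_common_endpoint {a b : ℝ} {u : ℝ → ℝ}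
    (H : SmallOscillation a b u)
    (hu : ContinuousOn u (Icc a b)) (ε : ℝ) (hε : 0 < ε) :
    ∃ h : ℝ, 0 < h ∧ ∀ x ∈ Icc a b, ∀ y ∈ Icc a b, ∀ z ∈ Icc a b, y ≠ x → z ≠ x →
      |y - x| ≤ h → |z - x| ≤ h →
      |Real.arctan (chordSlope u x y) - Real.arctan (chordSlope u x z)| ≤ ε := by
  obtain ⟨h, hh, H⟩ := H.arctan_sub_le hu (ε / 2) (half_pos hε)
  refine ⟨h / 2, half_pos hh, fun x hx y hy z hz hyx hzx hy' hz' => ?_⟩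
  rw [abs_le] at hy' hz'
  -- Both chords lie in the interval spanned by `x`, `y`, `z`.
  set s := min x (min y z) with hs
  set t := max x (max y z) with ht
  have s1 : s ≤ x := min_le_left _ _
  have s2 : s ≤ y := (min_le_right _ _).trans (min_le_left _ _)
  have s3 : s ≤ z := (min_le_right _ _).trans (min_le_right _ _)
  have t1 : x ≤ t := le_max_left _ _
  have t2 : y ≤ t := (le_max_left _ _).trans (le_max_right _ _)
  have t3 : z ≤ t := (le_max_right _ _).trans (le_max_right _ _)
  have sa : a ≤ s := le_min hx.1 (le_min hy.1 hz.1)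
  have tb : t ≤ b := max_le hx.2 (max_le hy.2 hz.2)
  have s4 : x - h / 2 ≤ s := le_min (by linarith) (le_min (by linarith) (by linarith))
  have t4 : t ≤ x + h / 2 := max_le (by linarith) (max_le (by linarith) (by linarith))
  have main : ∀ w, w ≠ x → s ≤ w → w ≤ t →
      |Real.arctan (chordSlope u x w) - Real.arctan (chordSlope u s t)| ≤ ε / 2 := by
    intro w hwx h1 h2
    rcases lt_or_gt_of_ne hwx with hlt | hgt
    · rw [chordSlope_comm u x w]
      exact H s t w x sa h1 hlt t1 tb (by linarith)
    · exact H s t x w sa s1 hgt h2 tb (by linarith)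
  have m1 := main y hyx s2 t2
  have m2 := main z hzx s3 t3
  rw [abs_le] at m1 m2 ⊢
  constructor <;> linarith [m1.1, m1.2, m2.1, m2.2]

/-- The inverse of the compactification `arctan : [-∞,∞] → [-π/2,π/2]`, extended by constants. -/
noncomputable def extTan (θ : ℝ) : EReal :=
  if θ ≤ -(Real.pi / 2) then ⊥ else if Real.pi / 2 ≤ θ then ⊤ else (Real.tan θ : ℝ)

lemma extTan_arctan (x : ℝ) : extTan (Real.arctan x) = x := by
  unfold extTan
  rw [if_neg (not_le.2 (Real.neg_pi_div_two_lt_arctan x)),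
    if_neg (not_le.2 (Real.arctan_lt_pi_div_two x)), Real.tan_arctan]

lemma continuous_extTan : Continuous extTan := by
  refine Monotone.continuous_of_surjective ?_ ?_
  · intro x y hxy
    unfold extTan
    split_ifs with h1 h2 h3 h4 h5 h6 <;> try simp
    · linarith
    · linarith
    · linarith
    · exact Real.strictMonoOn_tan.monotoneOn ⟨by linarith, by linarith⟩
        ⟨by linarith, by linarith⟩ hxy
  · intro y
    induction y with
    | bot => exact ⟨-(Real.pi / 2), by simp [extTan]⟩
    | top => exact ⟨Real.pi / 2, by
        rw [extTan, if_neg (by linarith [Real.pi_pos]), if_pos le_rfl]⟩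
    | coe y => exact ⟨Real.arctan y, extTan_arctan y⟩

lemma neBot_nhdsWithin_Icc_diff {a b x : ℝ} (hab : a < b) (hx : x ∈ Icc a b) :
    (𝓝[Icc a b \ {x}] x).NeBot := by
  have := (uniqueDiffOn_Icc hab x hx).accPt
  rw [accPt_principal_iff_nhdsWithin] at this
  exact this

lemma hasExtDeriv_coe_iff {a b : ℝ} {u : ℝ → ℝ} {x d : ℝ} :
    HasExtDeriv a b u x d ↔ HasDerivWithinAt u d (Icc a b) x := by
  rw [HasExtDeriv, EReal.tendsto_coe, hasDerivWithinAt_iff_tendsto_slope]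
  refine iff_of_eq (congrArg (fun f => Tendsto f _ _) ?_)
  ext y
  rw [chordSlope_comm, slope_def_field, chordSlope]

/-- Smallness of the oscillation of slopes yields partial regularity: the slopes of the chords at
`x` converge in the compactification `[-∞,∞]`, uniformly in `x`. -/
theorem SmallOscillation.partialRegularity {a b : ℝ} (hab : a < b) {u : ℝ → ℝ}
    (H : SmallOscillation a b u) (hu : ContinuousOn u (Icc a b)) : PartialRegularity a b u := by
  have hlim : ∀ x ∈ Icc a b, ∃ A : ℝ, Tendsto (fun y => Real.arctan (chordSlope u x y))
      (𝓝[Icc a b \ {x}] x) (𝓝 A) := by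
    intro x hx
    have := neBot_nhdsWithin_Icc_diff hab hx
    refine cauchy_map_iff_exists_tendsto.1 ?_
    rw [Metric.cauchy_iff]
    refine ⟨inferInstance, fun ε hε => ?_⟩
    obtain ⟨h, hh, H⟩ := H.arctan_sub_le_of_common_endpoint hu (ε / 2) (half_pos hε)
    refine ⟨_, image_mem_map (inter_mem (mem_nhdsWithin_of_mem_nhds
      (Metric.closedBall_mem_nhds x hh)) self_mem_nhdsWithin), ?_⟩
    rintro _ ⟨y, ⟨hy1, hy2⟩, rfl⟩ _ ⟨z, ⟨hz1, hz2⟩, rfl⟩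
    exact (H x hx y hy2.1 z hz2.1 hy2.2 hz2.2 hy1 hz1).trans_lt (by linarith)
  choose! A hA using hlim
  have hAc : ContinuousOn A (Icc a b) := by
    rw [Metric.continuousOn_iff]
    intro x hx ε hε
    obtain ⟨h, hh, H⟩ := H.arctan_sub_le_of_common_endpoint hu (ε / 3) (by positivity)
    have close : ∀ x ∈ Icc a b, ∀ y ∈ Icc a b, y ≠ x → |y - x| ≤ h →
        |A x - Real.arctan (chordSlope u x y)| ≤ ε / 3 := by
      intro x hx y hy hyx hyh
      have := neBot_nhdsWithin_Icc_diff hab hx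
      refine le_of_tendsto (((hA x hx).sub_const _).abs) ?_
      filter_upwards [mem_nhdsWithin_of_mem_nhds (Metric.closedBall_mem_nhds x hh),
        self_mem_nhdsWithin] with z hz1 hz2
      exact H x hx z hz2.1 y hy hz2.2 hyx hz1 hyh
    refine ⟨h, hh, fun y hy hyx => ?_⟩
    rw [Real.dist_eq] at hyx ⊢
    rcases eq_or_ne y x with rfl | hne
    · simpa using hε
    · have c1 := close x hx y hy hne hyx.le
      have c2 := close y hy x hx hne.symm (by rw [abs_sub_comm]; exact hyx.le)
      rw [chordSlope_comm u y x] at c2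
      rw [abs_le] at c1 c2
      rw [abs_lt]
      constructor <;> linarith [c1.1, c1.2, c2.1, c2.2]
  have hD : ∀ x ∈ Icc a b, HasExtDeriv a b u x (extTan (A x)) := by
    intro x hx
    have := (continuous_extTan.tendsto (A x)).comp (hA x hx)
    refine this.congr fun y => ?_
    simp [extTan_arctan]
  have hDc : ContinuousOn (fun x => extTan (A x)) (Icc a b) :=
    continuous_extTan.comp_continuousOn hAc
  have huniq : ∀ x ∈ Icc a b, ∀ d, HasExtDeriv a b u x d → extTan (A x) = d := by
    intro x hx d hd
    have := neBot_nhdsWithin_Icc_diff hab hx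
    exact tendsto_nhds_unique (hD x hx) hd
  have hmem : ∀ x ∈ Icc a b, x ∈ diffSet a b u ↔ extTan (A x) ∈ ({⊥, ⊤}ᶜ : Set EReal) := by
    intro x hx
    constructor
    · rintro ⟨-, hdiff⟩
      rw [huniq x hx _ (hasExtDeriv_coe_iff.2 hdiff.hasDerivWithinAt)]
      simp
    · intro h
      have h' := hD x hx
      simp only [mem_compl_iff, mem_insert_iff, mem_singleton_iff, not_or] at h
      rw [← EReal.coe_toReal h.2 h.1] at h'
      exact ⟨hx, (hasExtDeriv_coe_iff.1 h').differentiableWithinAt⟩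
  refine ⟨?_, ?_, fun x => extTan (A x), hD, hDc⟩
  · obtain ⟨U, hU, hUe⟩ := continuousOn_iff'.1 hDc {⊥, ⊤}ᶜ
      ((finite_singleton _).insert _).isClosed.isOpen_compl
    refine ⟨U, hU, ?_⟩
    rw [← hUe]
    ext x
    constructor
    · exact fun h => ⟨(hmem x h.1).1 h, h.1⟩
    · exact fun h => (hmem x h.2).2 h.1
  · ext x
    constructor
    · rintro ⟨hx, hx'⟩
      rw [hmem x hx, mem_compl_iff, not_not] at hx'
      have := hD x hx
      rcases hx' with h | h
      · exact ⟨hx, Or.inl (h ▸ this)⟩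
      · exact ⟨hx, Or.inr ((mem_singleton_iff.1 h) ▸ this)⟩
    · rintro ⟨hx, h⟩
      refine ⟨hx, ?_⟩
      rw [hmem x hx, mem_compl_iff, not_not]
      exact h.imp (huniq x hx _) (huniq x hx _)

/-! ### Telescoping along halved intervals -/

/-- If the slope changes by at most `ρ` of the length when an interval is at most halved, then the
slopes of arbitrary subintervals are controlled by the sum of `ρ` over dyadic scales. The bound
`ε ≤ 1` on these sums keeps all slopes met along the way below `k + 1`. -/
lemma abs_chordSlope_sub_le_sum {a b : ℝ} {u : ℝ → ℝ} {k h₀ ε : ℝ} {ρ : ℝ → ℝ}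
    (hρ : ∀ h, 0 < h → 0 ≤ ρ h)
    (step : ∀ s t p q : ℝ, a ≤ s → s ≤ p → p < q → q ≤ t → t ≤ b → t - s ≤ h₀ →
      |chordSlope u s t| ≤ k + 1 → t - s ≤ 2 * (q - p) →
        |chordSlope u p q - chordSlope u s t| ≤ ρ (t - s))
    (hε : ε ≤ 1) {s t : ℝ} (has : a ≤ s) (htb : t ≤ b) (hts : t - s ≤ h₀)
    (hk : |chordSlope u s t| ≤ k)
    (hsum : ∀ n : ℕ, ∑ j ∈ Finset.range n, ρ ((t - s) / 2 ^ j) ≤ ε) (n : ℕ) :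
    ∀ p q : ℝ, s ≤ p → p < q → q ≤ t → t - s ≤ 2 ^ n * (q - p) →
      |chordSlope u p q - chordSlope u s t| ≤ ∑ j ∈ Finset.range n, ρ ((t - s) / 2 ^ j) := by
  induction n with
  | zero =>
    intro p q hp hpq hq hlen
    obtain rfl : p = s := by linarith
    obtain rfl : q = t := by linarith
    simp
  | succ n ih =>
    intro p q hp hpq hq hlen
    have hpos : (0 : ℝ) < 2 ^ n := by positivity
    rw [Finset.sum_range_succ]
    by_cases hle : t - s ≤ 2 ^ n * (q - p)
    · exact (ih p q hp hpq hq hle).trans (le_add_of_nonneg_right (hρ _ (div_pos (by linarith) hpos)))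
    · push Not at hle
      -- An intermediate interval `[p', p' + d]` of the next larger dyadic length.
      set d := (t - s) / 2 ^ n with hd
      have hd' : 2 ^ n * d = t - s := by rw [hd]; field_simp
      have hdq : q - p < d := by
        rw [← hd'] at hle
        exact lt_of_mul_lt_mul_left hle hpos.le
      have hdt : d ≤ t - s := by
        rw [hd]
        exact div_le_self (by linarith) (one_le_pow₀ (by norm_num))
      have hd2 : d ≤ 2 * (q - p) := by
        have : 2 ^ n * d ≤ 2 ^ n * (2 * (q - p)) := by
          rw [hd']; rw [pow_succ] at hlen; linarith
        exact le_of_mul_le_mul_left this hpos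
      obtain ⟨p', h1, h2, h3, h4⟩ : ∃ p', s ≤ p' ∧ p' ≤ p ∧ q ≤ p' + d ∧ p' + d ≤ t := by
        refine ⟨max s (q - d), le_max_left _ _, max_le hp (by linarith), ?_, ?_⟩
        · linarith [le_max_right s (q - d)]
        · rw [max_add]
          exact max_le (by linarith) (by linarith)
      have i1 := ih p' (p' + d) h1 (by linarith) h4 (by rw [add_sub_cancel_left]; exact hd'.ge)
      have i2 : |chordSlope u p' (p' + d)| ≤ k + 1 := by
        have := abs_sub_abs_le_abs_sub (chordSlope u p' (p' + d)) (chordSlope u s t)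
        have := hsum n
        linarith
      have i3 := step p' (p' + d) p q (by linarith) h2 hpq h3 (by linarith) (by linarith) i2
        (by linarith)
      rw [add_sub_cancel_left] at i3
      calc |chordSlope u p q - chordSlope u s t|
          ≤ |chordSlope u p q - chordSlope u p' (p' + d)|
            + |chordSlope u p' (p' + d) - chordSlope u s t| := abs_sub_le _ _ _
        _ ≤ _ := by linarith

/-- The function `ρ` has small sums over the dyadic scales below small numbers. -/
def SmallDyadicSums (ρ : ℝ → ℝ) : Prop :=
  ∀ ε : ℝ, 0 < ε → ∃ h₀ : ℝ, 0 < h₀ ∧ ∀ h : ℝ, 0 < h → h ≤ h₀ →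
    ∀ n : ℕ, ∑ j ∈ Finset.range n, ρ (h / 2 ^ j) ≤ ε

lemma SmallDyadicSums.const_mul {ρ : ℝ → ℝ} (H : SmallDyadicSums ρ) {B : ℝ} (hB : 0 < B) :
    SmallDyadicSums (fun h => B * ρ h) := by
  intro ε hε
  obtain ⟨h₀, hh₀, H⟩ := H (ε / B) (div_pos hε hB)
  refine ⟨h₀, hh₀, fun h hh hle n => ?_⟩
  rw [← Finset.mul_sum, mul_comm, ← le_div_iff₀ hB]
  exact H h hh hle n

lemma SmallDyadicSums.add {ρ σ : ℝ → ℝ} (H : SmallDyadicSums ρ) (H' : SmallDyadicSums σ) :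
    SmallDyadicSums (fun h => ρ h + σ h) := by
  intro ε hε
  obtain ⟨h₁, hh₁, H⟩ := H (ε / 2) (half_pos hε)
  obtain ⟨h₂, hh₂, H'⟩ := H' (ε / 2) (half_pos hε)
  refine ⟨min h₁ h₂, lt_min hh₁ hh₂, fun h hh hle n => ?_⟩
  rw [Finset.sum_add_distrib]
  linarith [H h hh (hle.trans (min_le_left _ _)) n, H' h hh (hle.trans (min_le_right _ _)) n]

/-- Iteration of a one-step estimate, at slope level `k + 1`, along halved intervals. -/
lemma smallOscillation_of_step {a b : ℝ} {u : ℝ → ℝ}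
    (step : ∀ k : ℝ, 0 ≤ k → ∃ ρ : ℝ → ℝ, (∀ h, 0 < h → 0 ≤ ρ h) ∧ SmallDyadicSums ρ ∧
      ∃ h₀ : ℝ, 0 < h₀ ∧
      ∀ s t p q : ℝ, a ≤ s → s ≤ p → p < q → q ≤ t → t ≤ b → t - s ≤ h₀ →
        |chordSlope u s t| ≤ k → t - s ≤ 2 * (q - p) →
          |chordSlope u p q - chordSlope u s t| ≤ ρ (t - s)) :
    SmallOscillation a b u := by
  intro k hk ε hε
  obtain ⟨ρ, hρ, hsum, h₀, hh₀, step⟩ := step (k + 1) (by linarith)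
  obtain ⟨h₁, hh₁, hsum⟩ := hsum (min ε 1) (by positivity)
  refine ⟨min h₀ h₁, lt_min hh₀ hh₁, fun s t p q i1 i2 i3 i4 i5 i6 i7 => ?_⟩
  have hts := hsum (t - s) (by linarith) (i6.trans (min_le_right _ _))
  obtain ⟨n, hn⟩ := pow_unbounded_of_one_lt ((t - s) / (q - p)) (one_lt_two (α := ℝ))
  rw [div_lt_iff₀ (by linarith)] at hn
  exact ((abs_chordSlope_sub_le_sum hρ step (min_le_right ε 1) i1 i5 (i6.trans (min_le_left _ _)) i7
    hts n p q i2 i3 i4 hn.le).trans (hts n)).trans (min_le_left _ _)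

/-! ### Dyadic sums -/

lemma smallDyadicSums_rpow {β : ℝ} (hβ : 0 < β) : SmallDyadicSums (fun h => h ^ β) := by
  intro ε hε
  have hr : (2 : ℝ)⁻¹ ^ β < 1 := Real.rpow_lt_one (by norm_num) (by norm_num) hβ
  have hr0 : (0 : ℝ) ≤ 2⁻¹ ^ β := by positivity
  have hd : 0 < 1 - (2 : ℝ)⁻¹ ^ β := by linarith
  refine ⟨(ε * (1 - 2⁻¹ ^ β)) ^ β⁻¹, by positivity, fun h hh hle n => ?_⟩
  have hhβ : h ^ β ≤ ε * (1 - 2⁻¹ ^ β) := by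
    have := Real.rpow_le_rpow hh.le hle hβ.le
    rwa [Real.rpow_inv_rpow (by positivity) hβ.ne'] at this
  have hterm : ∀ j : ℕ, (h / 2 ^ j) ^ β = h ^ β * (2⁻¹ ^ β) ^ j := by
    intro j
    rw [div_eq_mul_inv, Real.mul_rpow hh.le (by positivity), ← inv_pow, Real.rpow_pow_comm
      (by norm_num)]
  simp_rw [hterm]
  rw [← Finset.mul_sum]
  calc h ^ β * ∑ j ∈ Finset.range n, ((2 : ℝ)⁻¹ ^ β) ^ j
      ≤ (ε * (1 - 2⁻¹ ^ β)) * (1 - 2⁻¹ ^ β)⁻¹ := by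
        refine mul_le_mul hhβ ?_ (by positivity) (by positivity)
        have := (summable_geometric_of_lt_one hr0 hr).sum_le_tsum (Finset.range n)
          (fun j _ => by positivity)
        rwa [tsum_geometric_of_lt_one hr0 hr] at this
    _ = ε := by rw [mul_assoc, mul_inv_cancel₀ hd.ne', mul_one]

lemma ofReal_le_two_mul_setLIntegral {f g : ℝ → ℝ} (hf : MonotoneOn f (Ioi 0))
    (hf0 : ∀ ξ, 0 < ξ → 0 ≤ f ξ) (hfg : ∀ ξ, 0 < ξ → f ξ ≤ g ξ) {r : ℝ} (hr : 0 < r) :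
    ENNReal.ofReal (f r) ≤ 2 * ∫⁻ ξ in Ico r (2 * r), ENNReal.ofReal (g ξ / ξ) := by
  have hle : ∫⁻ _ in Ico r (2 * r), ENNReal.ofReal (f r / (2 * r))
      ≤ ∫⁻ ξ in Ico r (2 * r), ENNReal.ofReal (g ξ / ξ) := by
    refine setLIntegral_mono' measurableSet_Ico fun ξ hξ => ENNReal.ofReal_le_ofReal ?_
    have hξ0 : 0 < ξ := hr.trans_le hξ.1
    exact div_le_div₀ ((hf0 ξ hξ0).trans (hfg ξ hξ0)) ((hf hr hξ0 hξ.1).trans (hfg ξ hξ0)) hξ0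
      hξ.2.le
  rw [setLIntegral_const, Real.volume_Ico, ← ENNReal.ofReal_mul (by have := hf0 r hr; positivity)]
    at hle
  calc ENNReal.ofReal (f r) = 2 * ENNReal.ofReal (f r / (2 * r) * (2 * r - r)) := by
        rw [← ENNReal.ofReal_ofNat 2, ← ENNReal.ofReal_mul (by norm_num)]
        congr 1
        field_simp
        ring
    _ ≤ _ := by gcongr

lemma ofReal_sum_le_two_mul_setLIntegral {f g : ℝ → ℝ} (hf : MonotoneOn f (Ioi 0))
    (hf0 : ∀ ξ, 0 < ξ → 0 ≤ f ξ) (hfg : ∀ ξ, 0 < ξ → f ξ ≤ g ξ) {h : ℝ} (hh : 0 < h) (n : ℕ) :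
    ENNReal.ofReal (∑ j ∈ Finset.range n, f (h / 2 ^ j))
      ≤ 2 * ∫⁻ ξ in Ico (2 * (h / 2 ^ n)) (2 * h), ENNReal.ofReal (g ξ / ξ) := by
  induction n with
  | zero => simp
  | succ n ih =>
    have hpos : 0 < h / 2 ^ n := by positivity
    have e1 : 2 * (h / 2 ^ (n + 1)) = h / 2 ^ n := by rw [pow_succ]; field_simp
    have hle : 2 * (h / 2 ^ n) ≤ 2 * h := by
      have := div_le_self hh.le (one_le_pow₀ (n := n) (one_le_two (α := ℝ)))
      linarith
    rw [Finset.sum_range_succ, ENNReal.ofReal_add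
      (Finset.sum_nonneg fun j _ => hf0 _ (by positivity)) (hf0 _ hpos), e1,
      ← Ico_union_Ico_eq_Ico (b := 2 * (h / 2 ^ n)) (by linarith) hle,
      lintegral_union measurableSet_Ico (Ico_disjoint_Ico_same), mul_add, add_comm]
    exact add_le_add (ofReal_le_two_mul_setLIntegral hf hf0 hfg hpos) ih

/-- By monotonicity each dyadic term `√ω(k, h / 2 ^ j)` is at most twice the integral of
`ω̄(k,ξ) / ξ` over `[h / 2 ^ j, 2 * (h / 2 ^ j)]`. -/
lemma smallDyadicSums_sqrt_of_dini {ω : ℝ → ℝ → ℝ} (hω : IsModulus ω) {N : ℝ} (hN : 0 < N)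
    {α : ℝ → ℝ} (H : DiniCondition ω N α) {k : ℝ} (hk : 0 ≤ k) :
    SmallDyadicSums (fun h => √(ω k h)) := by
  intro ε hε
  have hev := (H k hk).eventually
    (gt_mem_nhds (show (0 : ENNReal) < ENNReal.ofReal (ε / 2) by simpa using hε))
  rw [eventually_nhdsWithin_iff, Metric.eventually_nhds_iff] at hev
  obtain ⟨r, hr, hev⟩ := hev
  refine ⟨r / 2, half_pos hr, fun h hh hle n => ?_⟩
  have hmono : MonotoneOn (fun h => √(ω k h)) (Ioi 0) := fun x hx y hy hxy =>
    Real.sqrt_le_sqrt (hω.mono_right k hk (Ioi_subset_Ici_self hx) (Ioi_subset_Ici_self hy) hxy)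
  have hfg : ∀ ξ, 0 < ξ → √(ω k ξ) ≤ omegaBar ω N α k ξ := by
    intro ξ hξ
    have h1 : √(ω k ξ) ≤ omegaHat ω N k ξ :=
      Real.sqrt_le_sqrt (hω.mono_right k hk hξ.le (by simp only [mem_Ici]; positivity)
        (le_add_of_nonneg_right (by positivity)))
    have h2 : 0 ≤ √(omegaHat ω N k ξ) ^ α k := by positivity
    have h3 : 0 ≤ √(omegaHat ω N k ξ) := by positivity
    unfold omegaBar
    linarith
  have h1 := ofReal_sum_le_two_mul_setLIntegral hmono (fun _ _ => Real.sqrt_nonneg _) hfg hh n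
  have h2 : ∫⁻ ξ in Ico (2 * (h / 2 ^ n)) (2 * h), ENNReal.ofReal (omegaBar ω N α k ξ / ξ)
      ≤ ∫⁻ ξ in Ioo 0 (Real.exp 1 * h), ENNReal.ofReal (omegaBar ω N α k ξ / ξ) := by
    refine lintegral_mono_set fun ξ hξ => ⟨lt_of_lt_of_le (by positivity) hξ.1, hξ.2.trans_le ?_⟩
    have := Real.add_one_le_exp (1 : ℝ)
    nlinarith
  have h3 := hev (show dist h 0 < r by
    rw [Real.dist_eq, sub_zero, abs_of_pos hh]; linarith) hh
  have h4 : ENNReal.ofReal (∑ j ∈ Finset.range n, √(ω k (h / 2 ^ j))) ≤ ENNReal.ofReal ε := by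
    calc _ ≤ 2 * ENNReal.ofReal (ε / 2) := h1.trans (by gcongr; exact h2.trans h3.le)
      _ = ENNReal.ofReal ε := by
        rw [← ENNReal.ofReal_ofNat 2, ← ENNReal.ofReal_mul (by norm_num)]
        congr 1
        ring
  exact (ENNReal.ofReal_le_ofReal_iff hε.le).1 h4

/-! ### Pointwise consequences of ellipticity and Hölder continuity -/

lemma taylor_lower_bound {f : ℝ → ℝ} (hf : Differentiable ℝ f) (hf' : Differentiable ℝ (deriv f))
    {S : Set ℝ} (hS : Convex ℝ S) {m : ℝ} (hm : ∀ z ∈ S, m ≤ deriv (deriv f) z) {v w : ℝ}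
    (hv : v ∈ S) (hw : w ∈ S) :
    f v + deriv f v * (w - v) + m / 2 * (w - v) ^ 2 ≤ f w := by
  have hd : ∀ z, HasDerivAt (fun z => f z - m / 2 * z ^ 2) (deriv f z - m * z) z := by
    intro z
    have := (hf z).hasDerivAt.sub (((hasDerivAt_id z).pow 2).const_mul (m / 2))
    convert! this using 1
    simp
    ring
  have hd' : ∀ z, HasDerivAt (fun z => deriv f z - m * z) (deriv (deriv f) z - m) z := by
    intro z
    have := (hf' z).hasDerivAt.sub ((hasDerivAt_id z).const_mul m)
    convert! this using 1
    simp
  have hde : deriv (fun z => f z - m / 2 * z ^ 2) = fun z => deriv f z - m * z :=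
    funext fun z => (hd z).deriv
  have hconv : ConvexOn ℝ S (fun z => f z - m / 2 * z ^ 2) := by
    refine convexOn_of_deriv2_nonneg' hS (fun z _ => (hd z).differentiableAt.differentiableWithinAt)
      ?_ fun z hz => ?_
    · rw [hde]
      exact fun z _ => (hd' z).differentiableAt.differentiableWithinAt
    · simp only [Function.iterate_succ, Function.iterate_zero, Function.comp_apply, id]
      rw [hde, (hd' z).deriv]
      linarith [hm z hz]
  rcases lt_trichotomy v w with h | rfl | h
  · have := hconv.le_slope_of_hasDerivAt hv hw h (hd v)
    rw [slope_def_field, le_div_iff₀ (by linarith)] at this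
    linarith
  · simp
  · have := hconv.slope_le_of_hasDerivAt hw hv h (hd v)
    rw [slope_def_field, div_le_iff₀ (by linarith)] at this
    linarith

lemma GloballyElliptic.lower_bound {a b : ℝ} {L : ℝ × ℝ × ℝ → ℝ} {μ : ℝ}
    (H : GloballyElliptic a b L μ) {x : ℝ} (hx : x ∈ Icc a b) (y v w : ℝ) :
    L (x, y, v) + Lv L (x, y, v) * (w - v) + μ / 2 * (w - v) ^ 2 ≤ L (x, y, w) :=
  taylor_lower_bound (H.differentiable_L x hx y) (H.differentiable_Lv x hx y) convex_univ
    (fun z _ => H.le_Lvv (x, y, z) ⟨hx, mem_univ _⟩) (mem_univ v) (mem_univ w)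

lemma GloballyElliptic.abs_taylor_le {a b : ℝ} {L : ℝ × ℝ × ℝ → ℝ} {μ : ℝ}
    (H : GloballyElliptic a b L μ) {x : ℝ} (hx : x ∈ Icc a b) (y : ℝ) {S : Set ℝ}
    (hS : Convex ℝ S) {Λ : ℝ} (hΛ : ∀ z ∈ S, |Lvv L (x, y, z)| ≤ Λ) {v w : ℝ}
    (hv : v ∈ S) (hw : w ∈ S) :
    |L (x, y, w) - L (x, y, v) - Lv L (x, y, v) * (w - v)| ≤ Λ / 2 * (w - v) ^ 2 := by
  have hL := H.differentiable_L x hx y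
  have hLv := H.differentiable_Lv x hx y
  have h1 := taylor_lower_bound (m := -Λ) hL hLv hS (fun z hz => (abs_le.1 (hΛ z hz)).1) hv hw
  have hn : deriv (fun z => -L (x, y, z)) = fun z => -Lv L (x, y, z) := funext fun z => deriv.fun_neg
  have hn' : deriv (fun z => -Lv L (x, y, z)) = fun z => -Lvv L (x, y, z) :=
    funext fun z => deriv.fun_neg
  have h2 := taylor_lower_bound (f := fun z => -L (x, y, z)) (m := -Λ) hL.neg
    (by rw [hn]; exact hLv.neg) hS
    (fun z hz => by rw [hn, hn']; exact neg_le_neg (abs_le.1 (hΛ z hz)).2) hv hw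
  simp only [hn] at h2
  have h3 : deriv (fun z => L (x, y, z)) v = Lv L (x, y, v) := rfl
  rw [h3] at h1
  rw [abs_le]
  constructor <;> linarith

/-- On compact sets `L` is Hölder continuous in `(x,u)` and, thanks to the bound on `L_vv`, so is
`L_v`, with half the exponent: compare difference quotients of `L` in `v` with step `d ^ β`. -/
lemma exists_holder_bounds {a b : ℝ} {L : ℝ × ℝ × ℝ → ℝ} {μ : ℝ} (H1 : LocallyHolder a b L)
    (H2 : GloballyElliptic a b L μ) (R V : ℝ) :
    ∃ C > (0 : ℝ), ∃ β > (0 : ℝ), ∀ d : ℝ, 0 < d → d ≤ 1 → ∀ x ∈ Icc a b, ∀ x' ∈ Icc a b, ∀ y y' v : ℝ,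
      |y| ≤ R → |y'| ≤ R → |v| ≤ V → |x - x'| + |y - y'| ≤ d →
      |L (x, y, v) - L (x', y', v)| ≤ C * (d ^ β) ^ 2 ∧
        |Lv L (x, y, v) - Lv L (x', y', v)| ≤ C * d ^ β := by
  set G : Set (ℝ × ℝ × ℝ) := Icc a b ×ˢ Icc (-R) R ×ˢ Icc (-(V + 1)) (V + 1) with hG
  have hGc : IsCompact G := isCompact_Icc.prod (isCompact_Icc.prod isCompact_Icc)
  have hGs : G ⊆ lagDomain a b := fun p hp => ⟨hp.1, mem_univ _⟩
  obtain ⟨C, hC, α, hα, hH⟩ := H1 G hGc hGs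
  obtain ⟨Λ, hΛ⟩ := hGc.exists_bound_of_continuousOn (H2.continuousOn_Lvv.mono hGs)
  refine ⟨2 * C + |Λ|, by positivity, α / 2, half_pos hα, ?_⟩
  intro d hd hd1 x hx x' hx' y y' v hy hy' hv hdist
  set η := d ^ (α / 2) with hη
  have hη0 : 0 < η := Real.rpow_pos_of_pos hd _
  have hη1 : η ≤ 1 := Real.rpow_le_one hd.le hd1 (half_pos hα).le
  have hη2 : η ^ 2 = d ^ α := by
    rw [hη, ← Real.rpow_natCast, ← Real.rpow_mul hd.le]
    congr 1
    push_cast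
    ring
  have hLd : ∀ w, |w| ≤ V + 1 → |L (x, y, w) - L (x', y', w)| ≤ C * η ^ 2 := by
    intro w hw
    have := hH (x, y, w) ⟨hx, abs_le.1 hy, abs_le.1 hw⟩ (x', y', w) ⟨hx', abs_le.1 hy', abs_le.1 hw⟩
    refine this.trans ?_
    rw [hη2]
    simp only [sub_self, abs_zero, add_zero]
    gcongr
  have hvη : |v + η| ≤ V + 1 := by
    rw [abs_le] at hv ⊢
    constructor <;> linarith [hv.1, hv.2]
  have hT : ∀ x ∈ Icc a b, ∀ y, |y| ≤ R →
      |L (x, y, v + η) - L (x, y, v) - Lv L (x, y, v) * η| ≤ |Λ| / 2 * η ^ 2 := by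
    intro x hx y hy
    have := H2.abs_taylor_le hx y (convex_Icc (-(V + 1)) (V + 1)) (Λ := |Λ|) (v := v) (w := v + η)
      (fun z hz => (hΛ (x, y, z) ⟨hx, abs_le.1 hy, hz⟩).trans (le_abs_self _))
      (abs_le.1 (by linarith)) (abs_le.1 hvη)
    rwa [add_sub_cancel_left] at this
  have a1 := hLd v (by linarith)
  constructor
  · refine a1.trans ?_
    gcongr
    linarith [abs_nonneg Λ]
  · have a2 := hLd (v + η) hvη
    have a3 := hT x hx y hy
    have a4 := hT x' hx' y' hy'
    refine le_of_mul_le_mul_right ?_ hη0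
    calc |Lv L (x, y, v) - Lv L (x', y', v)| * η
        = |(Lv L (x, y, v) - Lv L (x', y', v)) * η| := by rw [abs_mul, abs_of_pos hη0]
      _ ≤ (2 * C + |Λ|) * η * η := by
        rw [abs_le] at a1 a2 a3 a4 ⊢
        constructor <;> nlinarith [a1.1, a1.2, a2.1, a2.2, a3.1, a3.2, a4.1, a4.2]

/-- The excess of `L` over its value on a chord dominates, up to a small error and to a multiple
of `w - v` with a constant coefficient, the square of `w - v`. -/
lemma exists_excess_lower_bound {a b : ℝ} {L : ℝ × ℝ × ℝ → ℝ} {μ : ℝ} (H1 : LocallyHolder a b L)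
    (hμ : 0 < μ) (H2 : GloballyElliptic a b L μ) (R V : ℝ) :
    ∃ C > (0 : ℝ), ∃ β > (0 : ℝ), ∀ d : ℝ, 0 < d → d ≤ 1 → ∀ x ∈ Icc a b, ∀ x₀ ∈ Icc a b,
      ∀ y y₀ z v w : ℝ, |y| ≤ R → |y₀| ≤ R → |z| ≤ R → |v| ≤ V →
      |x - x₀| + |y - y₀| ≤ d → |y - z| ≤ d →
      L (x, z, v) - C * d ^ β + Lv L (x₀, y₀, v) * (w - v) + μ / 4 * (w - v) ^ 2
        ≤ L (x, y, w) := by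
  obtain ⟨C, hC, β, hβ, H⟩ := exists_holder_bounds H1 H2 R V
  refine ⟨C + C ^ 2 / μ, by positivity, β * 2, by positivity, ?_⟩
  intro d hd hd1 x hx x₀ hx₀ y y₀ z v w hy hy₀ hz hv h1 h2
  have b1 := (H d hd hd1 x hx x hx y z v hy hz hv (by simpa using h2)).1
  have b2 := (H d hd hd1 x hx x₀ hx₀ y y₀ v hy hy₀ hv h1).2
  have b3 := H2.lower_bound hx y v w
  rw [Real.rpow_mul hd.le, Real.rpow_ofNat]
  set D := d ^ β
  set ζ := w - v
  have b4 : -(C * D * |ζ|) ≤ (Lv L (x, y, v) - Lv L (x₀, y₀, v)) * ζ := by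
    have := mul_le_mul_of_nonneg_right b2 (abs_nonneg ζ)
    rw [← abs_mul] at this
    exact (abs_le.1 this).1
  -- Young's inequality.
  have b5 : C * D * |ζ| ≤ μ / 4 * ζ ^ 2 + C ^ 2 / μ * D ^ 2 := by
    have : μ / 4 * ζ ^ 2 + C ^ 2 / μ * D ^ 2 - C * D * |ζ| = (μ / 2 * |ζ| - C * D) ^ 2 / μ := by
      rw [← sq_abs ζ]
      field_simp
      ring
    have h0 : 0 ≤ (μ / 2 * |ζ| - C * D) ^ 2 / μ := by positivity
    linarith
  have b6 := (abs_le.1 b1).1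
  linarith

/-! ### The integral estimate -/

lemma sq_integral_le {f : ℝ → ℝ} {p q : ℝ} (hpq : p < q) (hf : IntervalIntegrable f volume p q)
    (hf2 : IntervalIntegrable (fun x => f x ^ 2) volume p q) :
    (∫ x in p..q, f x) ^ 2 ≤ (q - p) * ∫ x in p..q, f x ^ 2 := by
  set I := ∫ x in p..q, f x with hI
  set m := I / (q - p) with hm
  have hpos : 0 < q - p := by linarith
  have h0 : 0 ≤ ∫ x in p..q, (f x - m) ^ 2 :=
    intervalIntegral.integral_nonneg hpq.le fun x _ => sq_nonneg _
  have he : ∫ x in p..q, (f x - m) ^ 2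
      = (∫ x in p..q, f x ^ 2) - 2 * m * I + m ^ 2 * (q - p) := by
    have : ∀ x, (f x - m) ^ 2 = f x ^ 2 - 2 * m * f x + m ^ 2 := fun x => by ring
    simp_rw [this]
    rw [intervalIntegral.integral_add (hf2.sub (hf.const_mul _)) (by simp),
      intervalIntegral.integral_sub hf2 (hf.const_mul _), intervalIntegral.integral_const_mul,
      intervalIntegral.integral_const, smul_eq_mul]
    ring
  have hmI : m * (q - p) = I := div_mul_cancel₀ _ hpos.ne'
  rw [he] at h0
  rw [← hmI] at h0 ⊢
  nlinarith

lemma integrableOn_sq_deriv {a b : ℝ} {u : ℝ → ℝ} {N : ℝ}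
    (h : eLpNorm (deriv u) 2 (volume.restrict (Icc a b)) ≤ ENNReal.ofReal N) :
    IntegrableOn (fun x => deriv u x ^ 2) (Icc a b) := by
  have hm : MemLp (deriv u) 2 (volume.restrict (Icc a b)) :=
    ⟨(measurable_deriv u).aestronglyMeasurable, h.trans_lt ENNReal.ofReal_lt_top⟩
  exact hm.integrable_sq

lemma intervalIntegrable_sq_deriv {a b : ℝ} {u : ℝ → ℝ} {N : ℝ}
    (h : eLpNorm (deriv u) 2 (volume.restrict (Icc a b)) ≤ ENNReal.ofReal N)
    {s t : ℝ} (has : a ≤ s) (hst : s ≤ t) (htb : t ≤ b) :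
    IntervalIntegrable (fun x => deriv u x ^ 2) volume s t := by
  rw [intervalIntegrable_iff_integrableOn_Ioc_of_le hst]
  exact (integrableOn_sq_deriv h).mono_set fun x hx => ⟨has.trans hx.1.le, hx.2.trans htb⟩

lemma intervalIntegrable_sq_sub_const {f : ℝ → ℝ} {s t : ℝ} (hf : IntervalIntegrable f volume s t)
    (hf2 : IntervalIntegrable (fun x => f x ^ 2) volume s t) (m : ℝ) :
    IntervalIntegrable (fun x => (f x - m) ^ 2) volume s t := by
  have : (fun x => (f x - m) ^ 2) = fun x => f x ^ 2 - 2 * m * f x + m ^ 2 := by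
    ext x
    ring
  rw [this]
  exact (hf2.sub (hf.const_mul _)).add (by simp)

lemma setIntegral_sq_deriv_le {a b : ℝ} {u : ℝ → ℝ} {N : ℝ} (hN : 0 ≤ N)
    (h : eLpNorm (deriv u) 2 (volume.restrict (Icc a b)) ≤ ENNReal.ofReal N) :
    ∫ x in Icc a b, deriv u x ^ 2 ≤ N ^ 2 := by
  have hm : MemLp (deriv u) 2 (volume.restrict (Icc a b)) :=
    ⟨(measurable_deriv u).aestronglyMeasurable, h.trans_lt ENNReal.ofReal_lt_top⟩
  rw [hm.eLpNorm_eq_integral_rpow_norm two_ne_zero ENNReal.ofNat_ne_top,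
    ENNReal.ofReal_le_ofReal_iff hN] at h
  simp only [ENNReal.toReal_ofNat, Real.rpow_ofNat, Real.norm_eq_abs, sq_abs] at h
  have h0 : 0 ≤ ∫ x in Icc a b, deriv u x ^ 2 := integral_nonneg fun x => sq_nonneg _
  have := pow_le_pow_left₀ (by positivity) h 2
  rwa [← Real.rpow_natCast (_ ^ (2 : ℝ)⁻¹), ← Real.rpow_mul h0, Nat.cast_ofNat,
    inv_mul_cancel₀ two_ne_zero, Real.rpow_one] at this

lemma absolutelyContinuousOnInterval_subinterval {u : ℝ → ℝ} {a b s t : ℝ}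
    (hu : AbsolutelyContinuousOnInterval u a b) (has : a ≤ s) (hst : s ≤ t) (htb : t ≤ b) :
    AbsolutelyContinuousOnInterval u s t :=
  hu.mono (by
    rw [uIcc_of_le hst, uIcc_of_le (has.trans (hst.trans htb))]
    exact Icc_subset_Icc has htb)

lemma abs_sub_le_mul_sqrt {a b : ℝ} {u : ℝ → ℝ} {N : ℝ} (hN : 0 ≤ N)
    (hu : AbsolutelyContinuousOnInterval u a b)
    (h : eLpNorm (deriv u) 2 (volume.restrict (Icc a b)) ≤ ENNReal.ofReal N)
    {s t : ℝ} (has : a ≤ s) (hst : s ≤ t) (htb : t ≤ b) :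
    |u t - u s| ≤ N * √(t - s) := by
  rcases hst.eq_or_lt with rfl | hst
  · simp
  have hu' := absolutelyContinuousOnInterval_subinterval hu has hst.le htb
  have hI := integrableOn_sq_deriv h
  have hsub : Ioc s t ⊆ Icc a b := fun x hx => ⟨has.trans hx.1.le, hx.2.trans htb⟩
  have h3 := sq_integral_le hst hu'.intervalIntegrable_deriv
    (intervalIntegrable_sq_deriv h has hst.le htb)
  rw [hu'.integral_deriv_eq_sub] at h3
  have h4 : ∫ x in s..t, deriv u x ^ 2 ≤ N ^ 2 := by
    rw [intervalIntegral.integral_of_le hst.le]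
    exact (setIntegral_mono_set hI (ae_of_all _ fun x => sq_nonneg _)
      (LE.le.eventuallyLE hsub)).trans (setIntegral_sq_deriv_le hN h)
  refine abs_le_of_sq_le_sq ?_ (by positivity)
  rw [mul_pow, Real.sq_sqrt (by linarith)]
  nlinarith

/-- The almost minimality, localized: outside `[s,t]` the energies of `u` and of its
modification cancel. -/
lemma integral_energyDensity_le_chord {a b : ℝ} {L : ℝ × ℝ × ℝ → ℝ}
    (hL : ContinuousOn L (lagDomain a b)) {u : ℝ → ℝ}
    (hint : IntervalIntegrable (energyDensity L u) volume a b) {s t e : ℝ} (has : a ≤ s)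
    (hst : s < t) (htb : t ≤ b) (h : energy a b L u ≤ energy a b L (chordReplace u s t) + e) :
    ∫ x in s..t, energyDensity L u x ≤
      (∫ x in s..t, L (x, u s + chordSlope u s t * (x - s), chordSlope u s t)) + e := by
  set k := chordSlope u s t with hk
  have out : ∀ x, x ∉ Icc s t →
      energyDensity L (chordReplace u s t) x = energyDensity L u x := by
    intro x hx
    have hev : chordReplace u s t =ᶠ[𝓝 x] u := by
      filter_upwards [isClosed_Icc.isOpen_compl.mem_nhds hx] with y hy
      exact if_neg fun hy' => hy (Ioo_subset_Icc_self hy')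
    unfold energyDensity
    rw [hev.deriv_eq, hev.eq_of_nhds]
  have ins : ∀ x ∈ Ioo s t,
      energyDensity L (chordReplace u s t) x = L (x, u s + k * (x - s), k) := by
    intro x hx
    have hev : chordReplace u s t =ᶠ[𝓝 x] fun y => u s + k * (y - s) := by
      filter_upwards [isOpen_Ioo.mem_nhds hx] with y hy
      exact if_pos hy
    have hd : HasDerivAt (fun y => u s + k * (y - s)) k x := by
      have := (((hasDerivAt_id x).sub_const s).const_mul k).const_add (u s)
      simpa using this
    unfold energyDensity
    rw [hev.deriv_eq, hev.eq_of_nhds, hd.deriv]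
  have e1 : EqOn (energyDensity L u) (energyDensity L (chordReplace u s t)) (uIoo a s) := by
    rw [uIoo_of_le has]
    exact fun x hx => (out x fun hx' => (hx.2.trans_le hx'.1).false).symm
  have e2 : EqOn (energyDensity L u) (energyDensity L (chordReplace u s t)) (uIoo t b) := by
    rw [uIoo_of_le htb]
    exact fun x hx => (out x fun hx' => (hx.1.trans_le hx'.2).false).symm
  have e3 : EqOn (fun x => L (x, u s + k * (x - s), k))
      (energyDensity L (chordReplace u s t)) (uIoo s t) := by
    rw [uIoo_of_le hst.le]
    exact fun x hx => (ins x hx).symm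
  have hsub : ∀ p q, a ≤ p → p ≤ q → q ≤ b → IntervalIntegrable (energyDensity L u) volume p q := by
    intro p q h1 h2 h3
    refine hint.mono_set ?_
    rw [uIcc_of_le h2, uIcc_of_le (h1.trans (h2.trans h3))]
    exact Icc_subset_Icc h1 h3
  have i1 := hsub a s le_rfl has (hst.le.trans htb)
  have i2 := hsub s t has hst.le htb
  have i3 := hsub t b (has.trans hst.le) htb le_rfl
  have i4 : IntervalIntegrable (fun x => L (x, u s + k * (x - s), k)) volume s t := by
    refine ContinuousOn.intervalIntegrable ?_
    rw [uIcc_of_le hst.le]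
    refine hL.comp (by fun_prop) fun x hx => ⟨⟨has.trans hx.1, hx.2.trans htb⟩, mem_univ _⟩
  have j1 := i1.congr_uIoo e1
  have j2 := i4.congr_uIoo e3
  have j3 := i3.congr_uIoo e2
  unfold energy at h
  rw [← intervalIntegral.integral_add_adjacent_intervals (i1.trans i2) i3,
    ← intervalIntegral.integral_add_adjacent_intervals i1 i2,
    ← intervalIntegral.integral_add_adjacent_intervals (j1.trans j2) j3,
    ← intervalIntegral.integral_add_adjacent_intervals j1 j2,
    intervalIntegral.integral_congr_uIoo e1, intervalIntegral.integral_congr_uIoo e2,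
    ← intervalIntegral.integral_congr_uIoo e3] at h
  linarith

/-- The mean square deviation of `u'` from the slope of a chord is small on short intervals with
bounded slope. -/
lemma exists_integral_sq_deriv_sub_le {a b : ℝ} {L : ℝ × ℝ × ℝ → ℝ}
    (hL : ContinuousOn L (lagDomain a b)) {K : Set (ℝ × ℝ)} {ω : ℝ → ℝ → ℝ} (hω : IsModulus ω)
    {c N δ₀ : ℝ} (hN : IsSlopeBound a b L K c N) (hδ₀ : 0 < δ₀) (H1 : LocallyHolder a b L)
    {μ : ℝ} (hμ : 0 < μ) (H2 : GloballyElliptic a b L μ) {u : ℝ → ℝ}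
    (hu : InClass a b L ω K c δ₀ u) {k : ℝ} (hk : 0 ≤ k) :
    ∃ B > (0 : ℝ), ∃ β > (0 : ℝ), ∃ h₀ > (0 : ℝ), ∀ s t : ℝ, a ≤ s → s < t → t ≤ b → t - s ≤ h₀ →
      |chordSlope u s t| ≤ k →
        ∫ x in s..t, (deriv u x - chordSlope u s t) ^ 2
          ≤ B * ((t - s) ^ β + ω k (t - s)) * (t - s) := by
  have hN0 := hN.1
  have hL2 := hN.2 u hu.toAdmissible
  have hac := hu.absolutelyContinuous
  rcases lt_or_ge b a with hba | hab
  · exact ⟨1, one_pos, 1, one_pos, 1, one_pos, fun s t h1 h2 h3 => by linarith⟩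
  obtain ⟨R, hR⟩ : ∃ R, ∀ x ∈ Icc a b, |u x| ≤ R := by
    have := hac.continuousOn
    rw [uIcc_of_le hab] at this
    exact isCompact_Icc.exists_bound_of_continuousOn this
  -- The values of a chord are at most `|u s| + |u t - u s| ≤ 3 * R`.
  obtain ⟨C, hC, β, hβ, hex⟩ := exists_excess_lower_bound H1 hμ H2 (3 * R) k
  set A := 1 + 2 * N with hA
  have hA0 : 0 < A := by positivity
  refine ⟨4 / μ * (C * A ^ β + 1), by positivity, β / 2, half_pos hβ,
    min δ₀ (min 1 ((1 / A) ^ 2)), by positivity, ?_⟩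
  intro s t has hst htb hlen hslope
  set m := chordSlope u s t with hm
  set h := t - s with hh
  have hh0 : 0 < h := by linarith
  have hhδ : h ≤ δ₀ := hlen.trans (min_le_left _ _)
  have hh1 : h ≤ 1 := hlen.trans ((min_le_right _ _).trans (min_le_left _ _))
  have hhA : √h ≤ 1 / A :=
    Real.sqrt_le_iff.2 ⟨by positivity, hlen.trans ((min_le_right _ _).trans (min_le_right _ _))⟩
  have hsq : h ≤ √h := by
    have h1 : √h ≤ 1 := Real.sqrt_le_one.2 hh1
    have h2 := Real.sq_sqrt hh0.le
    nlinarith [Real.sqrt_nonneg h]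
  -- The `ℓ¹` distance from `(x, u x)` to `(s, u s)` and the distance from `u x` to the chord are at
  -- most `d`, because `h ≤ √h` and `u` is Hölder continuous with exponent `1/2`.
  set d := A * √h with hd
  have hd0 : 0 < d := by positivity
  have hd1 : d ≤ 1 := by
    rw [le_div_iff₀ hA0] at hhA
    linarith
  have hdβ : d ^ β = A ^ β * h ^ (β / 2) := by
    rw [hd, Real.mul_rpow hA0.le (Real.sqrt_nonneg _), Real.sqrt_eq_rpow, ← Real.rpow_mul hh0.le]
    congr 2
    ring
  have hsm : s ∈ Icc a b := ⟨has, by linarith⟩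
  have htm : t ∈ Icc a b := ⟨by linarith, htb⟩
  have hmh : m * h = u t - u s := by
    rw [hm, chordSlope_comm, chordSlope, hh]
    exact div_mul_cancel₀ _ hh0.ne'
  have husub : ∀ x ∈ Icc s t, |u x - u s| ≤ N * √h := by
    intro x hx
    refine (abs_sub_le_mul_sqrt hN0.le hac hL2 has hx.1 (hx.2.trans htb)).trans ?_
    gcongr
    linarith [hx.2]
  have hline : ∀ x ∈ Icc s t, |m * (x - s)| ≤ |u t - u s| := by
    intro x hx
    rw [← hmh, abs_mul, abs_mul]
    refine mul_le_mul_of_nonneg_left ?_ (abs_nonneg _)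
    rw [abs_of_nonneg (by linarith [hx.1]), abs_of_pos hh0]
    linarith [hx.2]
  have hpt : ∀ x ∈ Icc s t, L (x, u s + m * (x - s), m) - C * d ^ β
      + Lv L (s, u s, m) * (deriv u x - m) + μ / 4 * (deriv u x - m) ^ 2
      ≤ energyDensity L u x := by
    intro x hx
    have hxm : x ∈ Icc a b := ⟨has.trans hx.1, hx.2.trans htb⟩
    have r1 := hR x hxm
    have r2 := hR s hsm
    have r3 := hR t htm
    have r0 := (abs_nonneg (u s)).trans r2
    have r4 := husub x hx
    have r5 := hline x hx
    have r6 := husub t ⟨hst.le, le_rfl⟩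
    refine hex d hd0 hd1 x hxm s hsm (u x) (u s) (u s + m * (x - s)) m (deriv u x) (by linarith)
      (by linarith) ?_ hslope ?_ ?_
    · have := abs_add_le (u s) (m * (x - s))
      have := abs_sub (u t) (u s)
      linarith
    · rw [abs_of_nonneg (by linarith [hx.1])]
      have : x - s ≤ √h := by linarith [hx.2]
      rw [hd, hA]
      linarith [mul_nonneg hN0.le (Real.sqrt_nonneg h)]
    · have : |u x - (u s + m * (x - s))| ≤ |u x - u s| + |m * (x - s)| := by
        rw [← sub_sub]
        exact abs_sub _ _
      rw [hd, hA]
      linarith [Real.sqrt_nonneg h]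
  have hac' := absolutelyContinuousOnInterval_subinterval hac has hst.le htb
  have hi1 : IntervalIntegrable (fun x => deriv u x - m) volume s t :=
    hac'.intervalIntegrable_deriv.sub (by simp)
  have hsq' := intervalIntegrable_sq_deriv hL2 has hst.le htb
  have hi2 := intervalIntegrable_sq_sub_const hac'.intervalIntegrable_deriv hsq' m
  have hi3 : IntervalIntegrable (fun x => L (x, u s + m * (x - s), m)) volume s t := by
    refine ContinuousOn.intervalIntegrable ?_
    rw [uIcc_of_le hst.le]
    refine hL.comp (by fun_prop) fun x hx => ⟨⟨has.trans hx.1, hx.2.trans htb⟩, mem_univ _⟩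
  have hi4 : IntervalIntegrable (energyDensity L u) volume s t := by
    refine hu.integrable.mono_set ?_
    rw [uIcc_of_le hst.le, uIcc_of_le hab]
    exact Icc_subset_Icc has htb
  have hzero : ∫ x in s..t, (deriv u x - m) = 0 := by
    rw [intervalIntegral.integral_sub hac'.intervalIntegrable_deriv (by simp),
      hac'.integral_deriv_eq_sub, intervalIntegral.integral_const, smul_eq_mul, ← hmh]
    ring
  have hconst : IntervalIntegrable (fun _ : ℝ => C * d ^ β) volume s t := by simp
  have hlow := intervalIntegral.integral_mono_on hst.le
    (((hi3.sub hconst).add (hi1.const_mul (Lv L (s, u s, m)))).add (hi2.const_mul (μ / 4))) hi4 hpt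
  rw [intervalIntegral.integral_add ((hi3.sub hconst).add (hi1.const_mul _)) (hi2.const_mul _),
    intervalIntegral.integral_add (hi3.sub hconst) (hi1.const_mul _),
    intervalIntegral.integral_sub hi3 hconst, intervalIntegral.integral_const, smul_eq_mul,
    intervalIntegral.integral_const_mul, intervalIntegral.integral_const_mul, hzero] at hlow
  have habs : |s - t| = h := by rw [abs_sub_comm, abs_of_pos hh0]
  have hmin := hu.almost_min s hsm t htm hst (by rw [habs]; exact hhδ)
  rw [habs] at hmin
  have hup := integral_energyDensity_le_chord hL hu.integrable has hst htb hmin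
  have hωk : ω |m| h ≤ ω k h := hω.mono_left h hh0.le (abs_nonneg m) hk hslope
  have hω0 := hω.nonneg k hk h hh0.le
  have hmain : μ / 4 * ∫ x in s..t, (deriv u x - m) ^ 2
      ≤ (C * A ^ β * h ^ (β / 2) + ω k h) * h := by
    rw [hdβ] at hlow
    have := mul_le_mul_of_nonneg_right hωk hh0.le
    linarith
  have hfin : (C * A ^ β * h ^ (β / 2) + ω k h) * h
      ≤ (C * A ^ β + 1) * (h ^ (β / 2) + ω k h) * h := by
    refine mul_le_mul_of_nonneg_right ?_ hh0.le
    have q1 : 0 ≤ C * A ^ β := by positivity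
    have q2 : 0 ≤ h ^ (β / 2) := by positivity
    nlinarith [mul_nonneg q1 hω0]
  calc ∫ x in s..t, (deriv u x - m) ^ 2
      = 4 / μ * (μ / 4 * ∫ x in s..t, (deriv u x - m) ^ 2) := by field_simp
    _ ≤ 4 / μ * ((C * A ^ β + 1) * (h ^ (β / 2) + ω k h) * h) :=
        mul_le_mul_of_nonneg_left (hmain.trans hfin) (by positivity)
    _ = _ := by ring

lemma sq_chordSlope_sub_le {u : ℝ → ℝ} {s t p q : ℝ} (hu : AbsolutelyContinuousOnInterval u s t)
    (hsq : IntervalIntegrable (fun x => deriv u x ^ 2) volume s t) (m : ℝ) (hsp : s ≤ p)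
    (hpq : p < q) (hqt : q ≤ t) :
    (chordSlope u p q - m) ^ 2 * (q - p) ≤ ∫ x in s..t, (deriv u x - m) ^ 2 := by
  have hst : s ≤ t := hsp.trans (hpq.le.trans hqt)
  have hi2 := intervalIntegrable_sq_sub_const hu.intervalIntegrable_deriv hsq m
  have hu' := absolutelyContinuousOnInterval_subinterval hu hsp hpq.le hqt
  have hsub : uIcc p q ⊆ uIcc s t := by
    rw [uIcc_of_le hpq.le, uIcc_of_le hst]
    exact Icc_subset_Icc hsp hqt
  have hcs := sq_integral_le hpq (hu'.intervalIntegrable_deriv.sub (g := fun _ => m) (by simp))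
    (hi2.mono_set hsub)
  have hval : ∫ x in p..q, (deriv u x - m) = (chordSlope u p q - m) * (q - p) := by
    rw [intervalIntegral.integral_sub hu'.intervalIntegrable_deriv (by simp),
      hu'.integral_deriv_eq_sub, intervalIntegral.integral_const, smul_eq_mul, chordSlope_comm,
      chordSlope]
    have : q - p ≠ 0 := by linarith
    field_simp
  have hmono : ∫ x in p..q, (deriv u x - m) ^ 2 ≤ ∫ x in s..t, (deriv u x - m) ^ 2 :=
    intervalIntegral.integral_mono_interval hsp hpq.le hqt (ae_of_all _ fun x => sq_nonneg _) hi2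
  rw [hval] at hcs
  refine le_of_mul_le_mul_right ?_ (sub_pos.2 hpq)
  nlinarith [mul_le_mul_of_nonneg_left hmono (sub_pos.2 hpq).le]

end Tonelli

theorem mainTheorem1 (a b : ℝ) (hab : a < b)
    (L : ℝ × ℝ × ℝ → ℝ) (hL : ContinuousOn L (Tonelli.lagDomain a b))
    (K : Set (ℝ × ℝ)) (hK : IsCompact K) (hKsub : K ⊆ Set.Icc a b ×ˢ Set.univ)
    (ω : ℝ → ℝ → ℝ) (hω : Tonelli.IsModulus ω)
    (c : ℝ) (hc : 0 < c)
    (N : ℝ) (hN : Tonelli.IsSlopeBound a b L K c N)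
    (δ₀ : ℝ) (hδ₀ : δ₀ ∈ Tonelli.DeltaSet N)
    (H1 : Tonelli.LocallyHolder a b L)
    (μ : ℝ) (hμ : 0 < μ) (H2 : Tonelli.GloballyElliptic a b L μ)
    (M α : ℝ → ℝ)
    (hM : ∀ k, 0 ≤ k → Tonelli.IsMConst a b L μ ω K N δ₀ k (M k))
    (hα : ∀ k, 0 ≤ k → Tonelli.IsHolderExponent a b L K N δ₀ k (M k) (α k))
    (H3 : Tonelli.DiniCondition ω N α)
    (u : ℝ → ℝ) (hu : Tonelli.InClass a b L ω K c δ₀ u) :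
    Tonelli.PartialRegularity a b u := by
  have hac := hu.absolutelyContinuous
  have hcont := hac.continuousOn
  rw [uIcc_of_le hab.le] at hcont
  refine (Tonelli.smallOscillation_of_step fun k hk => ?_).partialRegularity hab hcont
  obtain ⟨B, hB, β, hβ, h₀, hh₀, hest⟩ :=
    Tonelli.exists_integral_sq_deriv_sub_le hL hω hN hδ₀.1 H1 hμ H2 hu hk
  refine ⟨fun h => √(2 * B) * (h ^ (β / 2) + √(ω k h)), fun h hh => by positivity,
    ((Tonelli.smallDyadicSums_rpow (half_pos hβ)).add
      (Tonelli.smallDyadicSums_sqrt_of_dini hω hN.1 H3 hk)).const_mul (by positivity),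
    h₀, hh₀, ?_⟩
  intro s t p q has hsp hpq hqt htb hlen hslope hhalf
  have hst : s < t := by linarith
  have hh : 0 < t - s := by linarith
  have hsq := Tonelli.intervalIntegrable_sq_deriv (hN.2 u hu.toAdmissible) has hst.le htb
  have h1 := Tonelli.sq_chordSlope_sub_le
    (Tonelli.absolutelyContinuousOnInterval_subinterval hac has hst.le htb) hsq
    (Tonelli.chordSlope u s t) hsp hpq hqt
  have h2 := hest s t has hst htb hlen hslope
  have hω0 := hω.nonneg k hk (t - s) hh.le
  have hE : 0 ≤ (t - s) ^ β + ω k (t - s) := by positivity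
  have h3 : (Tonelli.chordSlope u p q - Tonelli.chordSlope u s t) ^ 2
      ≤ 2 * B * ((t - s) ^ β + ω k (t - s)) := by
    refine le_of_mul_le_mul_right ((h1.trans h2).trans ?_) (sub_pos.2 hpq)
    nlinarith [mul_le_mul_of_nonneg_left hhalf (mul_nonneg hB.le hE)]
  calc |Tonelli.chordSlope u p q - Tonelli.chordSlope u s t|
      ≤ √(2 * B * ((t - s) ^ β + ω k (t - s))) := Real.abs_le_sqrt h3
    _ = √(2 * B) * √((t - s) ^ β + ω k (t - s)) := Real.sqrt_mul (by positivity) _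
    _ ≤ √(2 * B) * ((t - s) ^ (β / 2) + √(ω k (t - s))) := by
      refine mul_le_mul_of_nonneg_left ?_ (Real.sqrt_nonneg _)
      have hroot : √((t - s) ^ β) = (t - s) ^ (β / 2) := by
        rw [Real.sqrt_eq_rpow, ← Real.rpow_mul hh.le, mul_one_div]
      rw [← hroot]
      refine Real.sqrt_le_iff.2 ⟨by positivity, ?_⟩
      rw [add_sq, Real.sq_sqrt (by positivity), Real.sq_sqrt hω0]
      have : 0 ≤ 2 * √((t - s) ^ β) * √(ω k (t - s)) := by positivity
      linarith
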